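/- Let $(W,S)$ be an arbitrary Coxeter system with length function $\ell$, identity $e$ and set of reflections $T=\bigcup_{w\in W} wSw^{-1}$. For $w\in W$ let $N(w)=\{t\in T : \ell(tw)<\ell(w)\}$ be its inversion set. The right weak order $\le_R$ on $W$ is defined by $u\le_R v$ if and only if $\ell(v)=\ell(u)+\ell(u^{-1}v)$, and $u\vee_R v$ denotes the least upper bound of $u$ and $v$ in this order, when it exists. For $A\subseteq T$, the Bruhat preclosure $\overline{A}$ is the set of all $t\in T$ for which there is a finite sequence $e=x_0,x_1,\dots,x_n=t$ in $W$ such that, for every $1\le i\le n$, $x_i=x_{i-1}t_i$ for some $t_i\in A$ and $\ell(x_{i-1})<\ell(x_i)$. Let $\overline{A}^{\,n}$ be the result of applying the Bruhat preclosure $n$ times to $A$, and let $\overline{A}^{\,\infty}=\bigcup_{n\in\mathbb N}\overline{A}^{\,n}$ be the infinite Bruhat closure of $A$. Theorem. Let $u,v\in W$ be bounded above in the right weak order, that is, suppose that there is $w\in W$ with $u\le_R w$ and $v\le_R w$. Then $u\vee_R v$ exists and $$N(u\vee_R v)=\overline{N(u)\cup N(v)}^{\,\infty}.$$ -/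

import Mathlib

namespace CoxeterSystem

section BruhatClosure

variable {B W : Type*} [Group W] {M : CoxeterMatrix B} (cs : CoxeterSystem M W)

/-- The (left) inversion set `N(w) = {t ∈ T | ℓ(t w) < ℓ(w)}`, where `T` is the set of
reflections. -/
def inversionSet (w : W) : Set W := {t | cs.IsLeftInversion w t}

/-- The right weak order on `W`: `u ≤ v` if and only if `ℓ(v) = ℓ(u) + ℓ(u⁻¹ v)`. -/
abbrev rightWeakOrder : PartialOrder W where
  le u v := cs.length v = cs.length u + cs.length (u⁻¹ * v)
  le_refl u := by simp
  le_trans u v w huv hvw := by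
    have h1 := cs.length_mul_le (u⁻¹ * v) (v⁻¹ * w)
    have h2 := cs.length_mul_le u (u⁻¹ * w)
    rw [show u⁻¹ * v * (v⁻¹ * w) = u⁻¹ * w by group] at h1
    rw [show u * (u⁻¹ * w) = w by group] at h2
    omega
  le_antisymm u v huv hvu := by
    have h : cs.length (u⁻¹ * v) = 0 := by omega
    exact inv_mul_eq_one.mp (cs.length_eq_zero_iff.mp h)

/-- `u ≤ v` in the right weak order. -/
def RightWeakLE (u v : W) : Prop := cs.rightWeakOrder.le u v

/-- `j` is the join (least upper bound) of `u` and `v` in the right weak order. -/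
def IsRightJoin (u v j : W) : Prop :=
  letI := cs.rightWeakOrder
  IsLUB {u, v} j

/-- There is an edge `x → y` of the Bruhat graph whose label lies in `A`:
`y = x t` with `t` a reflection in `A` and `ℓ(x) < ℓ(y)`. -/
def BruhatEdge (A : Set W) (x y : W) : Prop :=
  ∃ t ∈ A, cs.IsReflection t ∧ y = x * t ∧ cs.length x < cs.length y

/-- The (right) Bruhat preclosure of `A`: the reflections that can be reached from the identity
by a finite directed path in the Bruhat graph all of whose edge labels lie in `A`. -/
def bruhatPreclosure (A : Set W) : Set W :=
  {t | cs.IsReflection t ∧ Relation.ReflTransGen (cs.BruhatEdge A) 1 t}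

/-- The infinite Bruhat closure: the union over all `n` of the `n`-fold iterates of the Bruhat
preclosure. -/
def infiniteBruhatClosure (A : Set W) : Set W := ⋃ n : ℕ, cs.bruhatPreclosure^[n] A

end BruhatClosure

end CoxeterSystem

/-! Let A be the infinite closure of N(u) ∪ N(v). Inversion sets are closed under the preclosure, so
A ⊆ N(z) for every common upper bound z. It therefore suffices to find j with N(j) ⊆ A that lies
above u and v: then N(j) = A, and since the weak order is inclusion of inversion sets, j is the
join.

Such a j is the greatest element with N(j) ⊆ A (`exists_greatest_of_closed`), found by a
Newman-style induction whose local step is `exists_rightWeakLE_mul_simple_of_closed`. If x s and x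
s' cover x and have inversion sets in A, then x y does too, for every y in the parabolic subgroup of
s and s': the new inversions are conjugates x d x⁻¹ of parabolic reflections, reached from x s x⁻¹
and x s' x⁻¹ by a Bruhat path (`conj_mem_bruhatPreclosure`). A longest y gives an upper bound of
both covers.

Length comparisons are computed with a ZMod 2 cocycle (`reflectionParity_mul`,
`IsReflection.length_mul_lt_iff`). -/

namespace CoxeterSystem

/-! ### The parity cocycle, strong exchange and deletion. -/

section ReflectionParity

variable {B W : Type*} [Group W] {M : CoxeterMatrix B} (cs : CoxeterSystem M W)

open scoped Classical in
/-- The involution `(t, ε) ↦ (s t s, ε + [t = s])` of `W × ZMod 2` attached to a simple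
reflection `s`. -/
noncomputable def signedConj (i : B) : Equiv.Perm (W × ZMod 2) :=
  Function.Involutive.toPerm
    (fun p => (cs.simple i * p.1 * cs.simple i, p.2 + if p.1 = cs.simple i then 1 else 0)) (by
      rintro ⟨t, ε⟩
      have h : cs.simple i * t * cs.simple i = cs.simple i ↔ t = cs.simple i := by
        constructor
        · intro h
          have := congrArg (fun x => cs.simple i * x * cs.simple i) h
          simpa [mul_assoc] using this
        · rintro rfl
          simp
      ext
      · simp [mul_assoc]
      · by_cases ht : t = cs.simple i
        · subst ht
          simp [add_assoc]
          decide
        · simp [h, ht])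

open scoped Classical in
theorem signedConj_apply (i : B) (t : W) (ε : ZMod 2) :
    cs.signedConj i (t, ε) =
      (cs.simple i * t * cs.simple i, ε + if t = cs.simple i then 1 else 0) := rfl

theorem simple_mul_pow_conj (i i' : B) (k : ℕ) :
    ((cs.simple i * cs.simple i') ^ k)⁻¹ * cs.simple i' =
      cs.simple i' * (cs.simple i * cs.simple i') ^ k := by
  induction k with
  | zero => simp
  | succ k ih =>
    rw [pow_succ', mul_inv_rev, mul_assoc]
    have : (cs.simple i * cs.simple i')⁻¹ * cs.simple i' =
        cs.simple i' * (cs.simple i * cs.simple i') := by simp [mul_assoc]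
    rw [this, ← mul_assoc, ih, mul_assoc, ← pow_succ, ← pow_succ']

open scoped Classical in
theorem signedConj_mul_pow_apply (i i' : B) (k : ℕ) (t : W) (ε : ZMod 2) :
    ((cs.signedConj i * cs.signedConj i') ^ k) (t, ε) =
      ((cs.simple i * cs.simple i') ^ k * t * ((cs.simple i * cs.simple i') ^ k)⁻¹,
        ε + ∑ j ∈ Finset.range (2 * k),
          if t = cs.simple i' * (cs.simple i * cs.simple i') ^ j then 1 else 0) := by
  induction k with
  | zero => simp
  | succ k ih =>
    set g := cs.simple i * cs.simple i' with hg
    have h1 : g ^ k * t * (g ^ k)⁻¹ = cs.simple i' ↔ t = cs.simple i' * g ^ (2 * k) := by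
      rw [mul_inv_eq_iff_eq_mul, ← eq_inv_mul_iff_mul_eq, ← mul_assoc, hg,
        cs.simple_mul_pow_conj, mul_assoc, ← pow_add, two_mul]
    have h2 : cs.simple i' * (g ^ k * t * (g ^ k)⁻¹) * cs.simple i' = cs.simple i ↔
        t = cs.simple i' * g ^ (2 * k + 1) := by
      have h3 : cs.simple i' * (g ^ k * t * (g ^ k)⁻¹) * cs.simple i' = cs.simple i ↔
          g ^ k * t * (g ^ k)⁻¹ = cs.simple i' * g := by
        rw [hg, ← cs.inv_simple i', mul_inv_eq_iff_eq_mul, inv_mul_eq_iff_eq_mul]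
        simp
      rw [h3, mul_inv_eq_iff_eq_mul, ← eq_inv_mul_iff_mul_eq, ← mul_assoc, ← mul_assoc, hg,
        cs.simple_mul_pow_conj, ← hg, mul_assoc, mul_assoc, ← pow_succ', ← pow_add]
      ring_nf
    rw [pow_succ', Equiv.Perm.mul_apply, ih, Equiv.Perm.mul_apply, signedConj_apply,
      signedConj_apply, mul_add, mul_one, Finset.sum_range_succ, Finset.sum_range_succ]
    ext
    · simp [pow_succ', hg, mul_assoc]
    · simp only [h1, h2, add_assoc]

theorem isLiftable_signedConj : M.IsLiftable cs.signedConj := by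
  classical
  intro i i'
  ext1 ⟨t, ε⟩
  -- The summand has period `M i i'` in the exponent, so the two halves of the sum agree and cancel
  -- modulo 2.
  rw [signedConj_mul_pow_apply, two_mul, Finset.sum_range_add]
  simp only [pow_add, cs.simple_mul_simple_pow, one_mul, mul_one, inv_one, CharTwo.add_self_eq_zero,
    add_zero, Equiv.Perm.coe_one, id_eq]

/-- The action of `W` on `W × ZMod 2` extending the involutions `signedConj`. -/
noncomputable def signedConjHom : W →* Equiv.Perm (W × ZMod 2) :=
  cs.lift ⟨cs.signedConj, cs.isLiftable_signedConj⟩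

/-- The parity of the number of occurrences of `t` in the right inversion sequence of a word
for `w`. -/
noncomputable def reflectionParity (w t : W) : ZMod 2 := (cs.signedConjHom w (t, 0)).2

theorem signedConjHom_simple (i : B) : cs.signedConjHom (cs.simple i) = cs.signedConj i :=
  cs.lift_apply_simple cs.isLiftable_signedConj i

theorem signedConjHom_apply (w t : W) (ε : ZMod 2) :
    cs.signedConjHom w (t, ε) = (w * t * w⁻¹, ε + cs.reflectionParity w t) := by
  classical
  induction w using cs.simple_induction_left generalizing ε with
  | one => simp [reflectionParity]
  | mul_simple_left w i ih =>
    rw [reflectionParity, map_mul, Equiv.Perm.mul_apply, Equiv.Perm.mul_apply, ih, ih,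
      signedConjHom_simple, signedConj_apply, signedConj_apply]
    simp [mul_assoc, add_assoc]

theorem reflectionParity_one (t : W) : cs.reflectionParity 1 t = 0 := by
  simp [reflectionParity]

open scoped Classical in
theorem reflectionParity_simple (i : B) (t : W) :
    cs.reflectionParity (cs.simple i) t = if t = cs.simple i then 1 else 0 := by
  simp [reflectionParity, signedConjHom_simple, signedConj_apply]

/-- The cocycle rule, read off from multiplicativity of the action. It turns comparisons of lengths
into additions in ZMod 2. -/
theorem reflectionParity_mul (x y t : W) :
    cs.reflectionParity (x * y) t =
      cs.reflectionParity y t + cs.reflectionParity x (y * t * y⁻¹) := by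
  conv_lhs => rw [reflectionParity, map_mul, Equiv.Perm.mul_apply, signedConjHom_apply,
    signedConjHom_apply]
  simp

theorem reflectionParity_inv (w t : W) :
    cs.reflectionParity w⁻¹ t = cs.reflectionParity w (w⁻¹ * t * w) := by
  have h := cs.reflectionParity_mul w w⁻¹ t
  rw [mul_inv_cancel, reflectionParity_one, inv_inv] at h
  exact CharTwo.add_eq_zero.mp h.symm

theorem IsReflection.reflectionParity_self {cs : CoxeterSystem M W} {t : W}
    (ht : cs.IsReflection t) : cs.reflectionParity t t = 1 := by
  obtain ⟨w, i, rfl⟩ := ht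
  rw [reflectionParity_mul, reflectionParity_mul, reflectionParity_inv]
  simp [mul_assoc, reflectionParity_simple]
  rw [add_left_comm, CharTwo.add_self_eq_zero, add_zero]

theorem mem_rightInvSeq_of_reflectionParity_ne_zero {ω : List B} {t : W}
    (h : cs.reflectionParity (cs.wordProd ω) t ≠ 0) : t ∈ cs.rightInvSeq ω := by
  classical
  induction ω with
  | nil => simp [reflectionParity_one] at h
  | cons i ω ih =>
    rw [wordProd_cons, reflectionParity_mul, reflectionParity_simple] at h
    rw [rightInvSeq, List.mem_cons]
    by_cases h0 : cs.wordProd ω * t * (cs.wordProd ω)⁻¹ = cs.simple i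
    · left
      rw [← h0]
      group
    · right
      rw [if_neg h0, add_zero] at h
      exact ih h

theorem isRightInversion_of_reflectionParity_ne_zero {w t : W}
    (h : cs.reflectionParity w t ≠ 0) : cs.IsRightInversion w t := by
  obtain ⟨ω, hω, rfl⟩ := cs.exists_isReduced w
  exact cs.isRightInversion_of_mem_rightInvSeq hω
    (cs.mem_rightInvSeq_of_reflectionParity_ne_zero h)

theorem IsReflection.length_mul_lt_iff {cs : CoxeterSystem M W} {t : W} (ht : cs.IsReflection t)
    (w : W) : cs.length (w * t) < cs.length w ↔ cs.reflectionParity w t = 1 := by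
  constructor
  · intro hlt
    by_contra h
    have h0 : cs.reflectionParity w t = 0 := by
      generalize cs.reflectionParity w t = a at h
      revert a
      decide
    -- Parity 0 at w becomes parity 1 at w t, so t would also shorten w t.
    have h1 : cs.reflectionParity (w * t) t = 1 := by
      rw [reflectionParity_mul, ht.reflectionParity_self, mul_inv_cancel_right, h0, add_zero]
    have h2 := (cs.isRightInversion_of_reflectionParity_ne_zero (by rw [h1]; decide)).2
    rw [mul_assoc, ht.mul_self, mul_one] at h2
    omega
  · intro h
    exact (cs.isRightInversion_of_reflectionParity_ne_zero (by rw [h]; decide)).2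

theorem IsReflection.lt_length_mul_iff {cs : CoxeterSystem M W} {t : W} (ht : cs.IsReflection t)
    (w : W) : cs.length w < cs.length (w * t) ↔ cs.reflectionParity w t = 0 := by
  have h1 := ht.length_mul_lt_iff w
  have h2 := ht.length_mul_left_ne w
  have h3 : cs.reflectionParity w t = 0 ↔ ¬ cs.reflectionParity w t = 1 := by
    generalize cs.reflectionParity w t = a
    revert a
    decide
  rw [h3, ← h1]
  omega

theorem mem_inversionSet_iff {w t : W} :
    t ∈ cs.inversionSet w ↔ cs.IsReflection t ∧ cs.reflectionParity w⁻¹ t = 1 := by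
  rw [inversionSet, Set.mem_ofPred_eq, ← isRightInversion_inv_iff, IsRightInversion]
  exact and_congr_right fun ht => ht.length_mul_lt_iff _

/-- The strong exchange property for left inversions. -/
theorem IsLeftInversion.exists_eraseIdx {cs : CoxeterSystem M W} {ω : List B} {t : W}
    (h : cs.IsLeftInversion (cs.wordProd ω) t) :
    ∃ k < ω.length, t * cs.wordProd ω = cs.wordProd (ω.eraseIdx k) := by
  have hmem : t ∈ cs.leftInvSeq ω := by
    rw [← isRightInversion_inv_iff, ← wordProd_reverse] at h
    have := cs.mem_rightInvSeq_of_reflectionParity_ne_zero (ω := ω.reverse) (t := t) (by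
      rw [(h.1.length_mul_lt_iff _).mp h.2]
      decide)
    rwa [rightInvSeq_reverse, List.mem_reverse] at this
  obtain ⟨k, hk, rfl⟩ := List.mem_iff_getElem.mp hmem
  refine ⟨k, by simpa using hk, ?_⟩
  rw [← cs.getD_leftInvSeq_mul_wordProd, List.getD_eq_getElem]

/-- The deletion property: every word contains a reduced word for the same element. -/
theorem exists_sublist_isReduced (ω : List B) :
    ∃ ω' : List B, ω'.Sublist ω ∧ cs.IsReduced ω' ∧ cs.wordProd ω' = cs.wordProd ω := by
  induction ω with
  | nil => exact ⟨[], List.Sublist.refl _, by simp [IsReduced], rfl⟩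
  | cons i ω ih =>
    obtain ⟨ω', hsub, hred, hprod⟩ := ih
    rcases cs.length_simple_mul (cs.wordProd ω') i with h | h
    · refine ⟨i :: ω', hsub.cons_cons i, ?_, by rw [wordProd_cons, wordProd_cons, hprod]⟩
      rw [IsReduced, wordProd_cons, h, hred.eq, List.length_cons]
    · obtain ⟨k, hk, hE⟩ := IsLeftInversion.exists_eraseIdx (cs := cs) (ω := ω')
        (t := cs.simple i) ⟨cs.isReflection_simple i, by omega⟩
      refine ⟨ω'.eraseIdx k, ((List.eraseIdx_sublist ω' k).trans hsub).trans
        (List.sublist_cons_self i ω), ?_, by rw [← hE, wordProd_cons, hprod]⟩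
      have h1 := List.length_eraseIdx_add_one hk
      rw [IsReduced, ← hE]
      rw [hred.eq] at h
      omega

end ReflectionParity

/-! ### Standard parabolic subgroups and minimal coset representatives. -/

section ParabolicSubgroup

variable {B W : Type*} [Group W] {M : CoxeterMatrix B} (cs : CoxeterSystem M W)

/-- The standard parabolic subgroup generated by the simple reflections indexed by `J`. -/
def parabolic (J : Set B) : Subgroup W := Subgroup.closure (cs.simple '' J)

theorem simple_mem_parabolic {J : Set B} {i : B} (hi : i ∈ J) : cs.simple i ∈ cs.parabolic J :=
  Subgroup.subset_closure ⟨i, hi, rfl⟩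

theorem wordProd_mem_parabolic {J : Set B} {ω : List B} (h : ∀ i ∈ ω, i ∈ J) :
    cs.wordProd ω ∈ cs.parabolic J := by
  induction ω with
  | nil => simp [one_mem]
  | cons i ω ih =>
    rw [wordProd_cons]
    exact mul_mem (cs.simple_mem_parabolic (h i (by simp)))
      (ih fun j hj => h j (List.mem_cons_of_mem i hj))

theorem exists_isReduced_of_mem_parabolic {J : Set B} {y : W} (hy : y ∈ cs.parabolic J) :
    ∃ ω : List B, (∀ i ∈ ω, i ∈ J) ∧ cs.IsReduced ω ∧ cs.wordProd ω = y := by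
  suffices ∃ ω : List B, (∀ i ∈ ω, i ∈ J) ∧ cs.wordProd ω = y by
    obtain ⟨ω, hJ, rfl⟩ := this
    obtain ⟨ω', hsub, hred, hprod⟩ := cs.exists_sublist_isReduced ω
    exact ⟨ω', fun i hi => hJ i (hsub.subset hi), hred, hprod⟩
  induction hy using Subgroup.closure_induction with
  | mem x hx =>
    obtain ⟨i, hi, rfl⟩ := hx
    exact ⟨[i], by simpa using hi, by simp⟩
  | one => exact ⟨[], by simp, by simp⟩
  | mul x y _ _ hx hy =>
    obtain ⟨ω, hω, rfl⟩ := hx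
    obtain ⟨ω', hω', rfl⟩ := hy
    refine ⟨ω ++ ω', ?_, cs.wordProd_append ω ω'⟩
    intro i hi
    exact (List.mem_append.mp hi).elim (hω i) (hω' i)
  | inv x _ hx =>
    obtain ⟨ω, hω, rfl⟩ := hx
    exact ⟨ω.reverse, fun i hi => hω i (List.mem_reverse.mp hi), cs.wordProd_reverse ω⟩

theorem mem_parabolic_of_mem_inversionSet {J : Set B} {y t : W} (hy : y ∈ cs.parabolic J)
    (ht : t ∈ cs.inversionSet y) : t ∈ cs.parabolic J := by
  obtain ⟨ω, hJ, -, rfl⟩ := cs.exists_isReduced_of_mem_parabolic hy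
  obtain ⟨k, -, hE⟩ := IsLeftInversion.exists_eraseIdx ht
  have h1 := cs.wordProd_mem_parabolic (J := J) (ω := ω.eraseIdx k)
    fun i hi => hJ i ((List.eraseIdx_sublist ω k).subset hi)
  rw [← hE] at h1
  exact (Subgroup.mul_mem_cancel_right _ hy).mp h1

theorem IsReduced.of_append_singleton {cs : CoxeterSystem M W} {ω : List B} {i : B}
    (h : cs.IsReduced (ω ++ [i])) :
    cs.IsReduced ω ∧ cs.length (cs.wordProd ω) < cs.length (cs.wordProd ω * cs.simple i) := by
  have h1 : cs.IsReduced ω := by simpa using h.take ω.length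
  refine ⟨h1, ?_⟩
  have h2 := h.eq
  rw [wordProd_append, wordProd_singleton] at h2
  rw [h2, h1.eq]
  simp

/-- Appending a letter s to a reduced word for p keeps x p s growing: the parity of x p at s is that
of p at s plus that of x at p s p⁻¹, and both vanish. The hypothesis on all reflections is later
weakened to simple ones. -/
theorem length_mul_of_forall_isReflection {J : Set B} {x : W}
    (hx : ∀ d ∈ cs.parabolic J, cs.IsReflection d → cs.length x < cs.length (x * d))
    {y : W} (hy : y ∈ cs.parabolic J) : cs.length (x * y) = cs.length x + cs.length y := by
  obtain ⟨ω, hJ, hred, rfl⟩ := cs.exists_isReduced_of_mem_parabolic hy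
  clear hy
  induction ω using List.reverseRecOn with
  | nil => simp
  | append_singleton ω i ih =>
    obtain ⟨hred', hlt⟩ := hred.of_append_singleton
    have hJ' : ∀ j ∈ ω, j ∈ J := fun j hj => hJ j (by simp [hj])
    have hi : i ∈ J := hJ i (by simp)
    have hs := cs.isReflection_simple i
    have hp := cs.wordProd_mem_parabolic hJ'
    specialize ih hJ' hred'
    have h1 := (hs.lt_length_mul_iff _).mp hlt
    have hc := hs.conj (cs.wordProd ω)
    have h2 := (hc.lt_length_mul_iff x).mp
      (hx _ (mul_mem (mul_mem hp (cs.simple_mem_parabolic hi)) (inv_mem hp)) hc)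
    have h3 : cs.length (x * cs.wordProd ω) < cs.length (x * cs.wordProd ω * cs.simple i) := by
      rw [hs.lt_length_mul_iff, reflectionParity_mul, h1, h2, add_zero]
    rw [wordProd_append, wordProd_singleton, ← mul_assoc]
    rcases cs.length_mul_simple (x * cs.wordProd ω) i with h | h <;>
    rcases cs.length_mul_simple (cs.wordProd ω) i with h' | h' <;> omega

/-- An element without right descents in `J` is the shortest element of its coset, and lengths
add. -/
theorem length_mul_of_mem_parabolic {J : Set B} {x : W}
    (hx : ∀ i ∈ J, cs.length x < cs.length (x * cs.simple i))
    {y : W} (hy : y ∈ cs.parabolic J) : cs.length (x * y) = cs.length x + cs.length y := by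
  obtain ⟨p, hp, hmin⟩ : ∃ p ∈ cs.parabolic J, ∀ q ∈ cs.parabolic J,
      cs.length (x * p) ≤ cs.length (x * q) := by
    obtain ⟨p, hp, hmin⟩ := exists_minimalFor_of_wellFoundedLT (· ∈ cs.parabolic J)
      (fun p => cs.length (x * p)) ⟨1, one_mem _⟩
    exact ⟨p, hp, fun q hq => (le_total _ _).elim id (hmin hq)⟩
  have hadd := fun {z : W} (hz : z ∈ cs.parabolic J) =>
    cs.length_mul_of_forall_isReflection (x := x * p) (J := J) (fun d hd hr =>
      lt_of_le_of_ne (by rw [mul_assoc]; exact hmin _ (mul_mem hp hd))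
        (hr.length_mul_left_ne _).symm) hz
  -- Lengths add along x = (x p) p⁻¹, so the last letter of a reduced word for p⁻¹ ≠ 1 would be a
  -- right descent of x in J.
  have hp1 : p = 1 := by
    obtain ⟨ω, hJ, hred, hω⟩ := cs.exists_isReduced_of_mem_parabolic (inv_mem hp)
    cases ω using List.reverseRecOn with
    | nil => simpa using hω.symm
    | append_singleton ω i =>
      exfalso
      have hxl := hadd (inv_mem hp)
      rw [mul_inv_cancel_right] at hxl
      have h1 : x * cs.simple i = x * p * cs.wordProd ω := by
        rw [wordProd_append, wordProd_singleton] at hω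
        rw [← inv_inv p, ← hω]
        simp [mul_assoc]
      have h2 := hx i (hJ i (by simp))
      have h3 := hadd (cs.wordProd_mem_parabolic (J := J) (ω := ω) fun j hj => hJ j (by simp [hj]))
      rw [h1, h3, hxl, ← hω, hred.eq, hred.of_append_singleton.1.eq] at h2
      simp at h2
  subst hp1
  simpa using hadd hy

end ParabolicSubgroup

/-! ### The weak order as inclusion of inversion sets. -/

section WeakOrder

variable {B W : Type*} [Group W] {M : CoxeterMatrix B} (cs : CoxeterSystem M W)

theorem rightWeakLE_iff {u v : W} :
    cs.RightWeakLE u v ↔ cs.length v = cs.length u + cs.length (u⁻¹ * v) := Iff.rfl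

theorem RightWeakLE.inversionSet_subset {cs : CoxeterSystem M W} {u v : W}
    (h : cs.RightWeakLE u v) : cs.inversionSet u ⊆ cs.inversionSet v := by
  rintro t ⟨ht, hlt⟩
  refine ⟨ht, ?_⟩
  have h1 := cs.length_mul_le (t * u) (u⁻¹ * v)
  rw [show t * u * (u⁻¹ * v) = t * v by group] at h1
  rw [rightWeakLE_iff] at h
  omega

theorem RightWeakLE.trans {cs : CoxeterSystem M W} {u v w : W}
    (h : cs.RightWeakLE u v) (h' : cs.RightWeakLE v w) : cs.RightWeakLE u w :=
  cs.rightWeakOrder.le_trans u v w h h'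

theorem rightWeakLE_mul_simple {w : W} {i : B} (h : cs.length w < cs.length (w * cs.simple i)) :
    cs.RightWeakLE w (w * cs.simple i) := by
  rw [rightWeakLE_iff, inv_mul_cancel_left, length_simple]
  rcases cs.length_mul_simple w i with h' | h' <;> omega

theorem rightWeakLE_iff_inversionSet_subset {u v : W} :
    cs.RightWeakLE u v ↔ cs.inversionSet u ⊆ cs.inversionSet v := by
  refine ⟨RightWeakLE.inversionSet_subset, fun h => ?_⟩
  obtain ⟨ω, hω, rfl⟩ := cs.exists_isReduced u
  induction ω using List.reverseRecOn with
  | nil => simp [rightWeakLE_iff]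
  | append_singleton ω i ih =>
    obtain ⟨hred, hlt⟩ := hω.of_append_singleton
    rw [wordProd_append, wordProd_singleton] at h ⊢
    set p := cs.wordProd ω
    have hp := ih hred ((cs.rightWeakLE_mul_simple hlt).inversionSet_subset.trans h)
    have hs := cs.isReflection_simple i
    have ht : p * cs.simple i * p⁻¹ ∈ cs.inversionSet (p * cs.simple i) :=
      ⟨hs.conj p, by simpa [mul_assoc] using hlt⟩
    -- The reflection p s p⁻¹ is an inversion of v but not of p, so by the cocycle rule s is a left
    -- descent of p⁻¹ v.
    have h1 := (cs.mem_inversionSet_iff.mp (h ht)).2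
    rw [show v⁻¹ = (p⁻¹ * v)⁻¹ * p⁻¹ by group, reflectionParity_mul, reflectionParity_inv,
      show p⁻¹ * (p * cs.simple i * p⁻¹) * p = cs.simple i by group,
      (hs.lt_length_mul_iff p).mp hlt, zero_add,
      show p⁻¹ * (p * cs.simple i * p⁻¹) * p⁻¹⁻¹ = cs.simple i by group] at h1
    have h2 : cs.length (cs.simple i * (p⁻¹ * v)) < cs.length (p⁻¹ * v) :=
      (cs.mem_inversionSet_iff.mpr ⟨hs, h1⟩).2
    rw [rightWeakLE_iff] at hp ⊢
    rw [mul_inv_rev, inv_simple, mul_assoc]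
    rcases cs.length_simple_mul (p⁻¹ * v) i with h' | h' <;>
    rcases cs.length_mul_simple p i with h'' | h'' <;> omega

theorem RightWeakLE.exists_mul_simple {cs : CoxeterSystem M W} {u v : W}
    (h : cs.RightWeakLE u v) (hne : u ≠ v) :
    ∃ i, cs.length u < cs.length (u * cs.simple i) ∧ cs.RightWeakLE (u * cs.simple i) v := by
  obtain ⟨i, hi⟩ := cs.exists_leftDescent_of_ne_one (w := u⁻¹ * v)
    (fun h' => hne (inv_mul_eq_one.mp h'))
  rw [IsLeftDescent] at hi
  have h1 := cs.length_mul_le (u * cs.simple i) (cs.simple i * (u⁻¹ * v))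
  rw [show u * cs.simple i * (cs.simple i * (u⁻¹ * v)) = v by simp [mul_assoc]] at h1
  rw [rightWeakLE_iff] at h
  refine ⟨i, by omega, ?_⟩
  rw [rightWeakLE_iff, mul_inv_rev, inv_simple, mul_assoc]
  rcases cs.length_simple_mul (u⁻¹ * v) i with h' | h' <;>
  rcases cs.length_mul_simple u i with h'' | h'' <;> omega

end WeakOrder

/-! ### Bruhat preclosure and its iterates. -/

section Closure

variable {B W : Type*} [Group W] {M : CoxeterMatrix B} (cs : CoxeterSystem M W)

theorem bruhatPreclosure_mono : Monotone cs.bruhatPreclosure := by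
  rintro A A' h t ⟨ht, hpath⟩
  exact ⟨ht, Relation.ReflTransGen.mono (fun _ _ ⟨s, hs, hrest⟩ => ⟨s, h hs, hrest⟩) _ _ hpath⟩

theorem subset_bruhatPreclosure {A : Set W} (hA : ∀ t ∈ A, cs.IsReflection t) :
    A ⊆ cs.bruhatPreclosure A := by
  intro t ht
  refine ⟨hA t ht, Relation.ReflTransGen.single ⟨t, ht, hA t ht, (one_mul t).symm, ?_⟩⟩
  have := (hA t ht).odd_length.pos
  rwa [length_one]

/-- Inversion sets are closed under the Bruhat preclosure. -/
theorem bruhatPreclosure_inversionSet_subset (w : W) :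
    cs.bruhatPreclosure (cs.inversionSet w) ⊆ cs.inversionSet w := by
  rintro t ⟨ht, hpath⟩
  have key : ∀ x, Relation.ReflTransGen (cs.BruhatEdge (cs.inversionSet w)) 1 x →
      x = 1 ∨ cs.length (x * w) < cs.length w := by
    intro x hx
    induction hx with
    | refl => exact Or.inl rfl
    | @tail x y _ hxy ih =>
      obtain ⟨s, hs, hsr, rfl, hlt⟩ := hxy
      right
      have hle : cs.length (x * w) ≤ cs.length w := by
        rcases ih with rfl | ih
        · simp
        · exact ih.le
      have hx0 := (hsr.lt_length_mul_iff x).mp hlt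
      have hs1 := (cs.mem_inversionSet_iff.mp hs).2
      rw [reflectionParity_inv] at hs1
      have hc : cs.IsReflection (w⁻¹ * s * w) := by simpa using hsr.conj w⁻¹
      -- Since s inverts w, going up from x to x s means going down from x w to x s w.
      have h1 : cs.length (x * w * (w⁻¹ * s * w)) < cs.length (x * w) := by
        rw [hc.length_mul_lt_iff, reflectionParity_mul, hs1,
          show w * (w⁻¹ * s * w) * w⁻¹ = s by group, hx0, add_zero]
      rw [show x * w * (w⁻¹ * s * w) = x * s * w by group] at h1
      omega
  rcases key t hpath with rfl | h
  · exact absurd ht.odd_length (by simp)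
  · exact ⟨ht, h⟩

theorem iterate_bruhatPreclosure_mono (A : Set W) (hA : ∀ t ∈ A, cs.IsReflection t) :
    Monotone fun n : ℕ => cs.bruhatPreclosure^[n] A := by
  refine monotone_nat_of_le_succ fun n => ?_
  rw [Function.iterate_succ_apply']
  refine cs.subset_bruhatPreclosure ?_
  cases n with
  | zero => exact hA
  | succ n =>
    rw [Function.iterate_succ_apply']
    exact fun t ht => ht.1

theorem subset_infiniteBruhatClosure (A : Set W) : A ⊆ cs.infiniteBruhatClosure A :=
  Set.subset_iUnion (fun n : ℕ => cs.bruhatPreclosure^[n] A) 0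

/-- A path is finite and the iterates increase, so all its labels already lie in one iterate. -/
theorem bruhatPreclosure_infiniteBruhatClosure_subset {A : Set W}
    (hA : ∀ t ∈ A, cs.IsReflection t) :
    cs.bruhatPreclosure (cs.infiniteBruhatClosure A) ⊆ cs.infiniteBruhatClosure A := by
  rintro t ⟨ht, hpath⟩
  have key : ∀ x, Relation.ReflTransGen (cs.BruhatEdge (cs.infiniteBruhatClosure A)) 1 x →
      ∃ n : ℕ, Relation.ReflTransGen (cs.BruhatEdge (cs.bruhatPreclosure^[n] A)) 1 x := by
    intro x hx
    induction hx with
    | refl => exact ⟨0, Relation.ReflTransGen.refl⟩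
    | tail _ hxy ih =>
      obtain ⟨n, hn⟩ := ih
      obtain ⟨s, hs, hrest⟩ := hxy
      obtain ⟨m, hm⟩ := Set.mem_iUnion.mp hs
      have hmono := cs.iterate_bruhatPreclosure_mono A hA
      refine ⟨max n m, (Relation.ReflTransGen.mono ?_ _ _ hn).tail ⟨s, hmono (le_max_right n m) hm, hrest⟩⟩
      rintro a b ⟨r, hr, hrest'⟩
      exact ⟨r, hmono (le_max_left n m) hr, hrest'⟩
  obtain ⟨n, hn⟩ := key t hpath
  refine Set.mem_iUnion.mpr ⟨n + 1, ?_⟩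
  rw [Function.iterate_succ_apply']
  exact ⟨ht, hn⟩

theorem infiniteBruhatClosure_subset_inversionSet {A : Set W} {w : W}
    (h : A ⊆ cs.inversionSet w) : cs.infiniteBruhatClosure A ⊆ cs.inversionSet w := by
  refine Set.iUnion_subset fun n => ?_
  induction n with
  | zero => exact h
  | succ n ih =>
    rw [Function.iterate_succ_apply']
    exact (cs.bruhatPreclosure_mono ih).trans (cs.bruhatPreclosure_inversionSet_subset w)

/-- If `x` has no right descents in `J`, then the conjugates by `x` of the reflections of the
parabolic subgroup `W_J` lie in the Bruhat preclosure of the conjugates of its generators. -/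
theorem conj_mem_bruhatPreclosure {A : Set W} {J : Set B} {x : W}
    (hx : ∀ i ∈ J, cs.length x < cs.length (x * cs.simple i))
    (hA : ∀ i ∈ J, x * cs.simple i * x⁻¹ ∈ A) {d : W} (hd : cs.IsReflection d)
    (hdJ : d ∈ cs.parabolic J) : x * d * x⁻¹ ∈ cs.bruhatPreclosure A := by
  refine ⟨hd.conj x, ?_⟩
  obtain ⟨ω, hJ, hred, rfl⟩ := cs.exists_isReduced_of_mem_parabolic hdJ
  clear hd hdJ
  induction ω using List.reverseRecOn with
  | nil => simpa using Relation.ReflTransGen.refl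
  | append_singleton ω i ih =>
    obtain ⟨hred', hlt⟩ := hred.of_append_singleton
    have hJ' : ∀ j ∈ ω, j ∈ J := fun j hj => hJ j (by simp [hj])
    have hi : i ∈ J := hJ i (by simp)
    have hs := cs.isReflection_simple i
    -- The path consists of the x-conjugates of the prefixes of a reduced word for d.
    refine (ih hJ' hred').tail ⟨x * cs.simple i * x⁻¹, hA i hi, hs.conj x, ?_, ?_⟩
    · rw [wordProd_append, wordProd_singleton]
      group
    · rw [wordProd_append, wordProd_singleton]
      set p := cs.wordProd ω
      have hp : p ∈ cs.parabolic J := cs.wordProd_mem_parabolic hJ'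
      have hc := hs.conj p
      have hcJ := mul_mem (mul_mem hp (cs.simple_mem_parabolic hi)) (inv_mem hp)
      have h1 : cs.reflectionParity x (p * cs.simple i * p⁻¹) = 0 := by
        rw [← hc.lt_length_mul_iff, cs.length_mul_of_mem_parabolic hx hcJ]
        have := hc.odd_length.pos
        omega
      rw [show x * (p * cs.simple i) * x⁻¹ = x * p * x⁻¹ * (x * cs.simple i * x⁻¹) by group,
        (hs.conj x).lt_length_mul_iff, reflectionParity_mul, reflectionParity_inv,
        show x⁻¹ * (x * cs.simple i * x⁻¹) * x = cs.simple i by group,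
        (hs.lt_length_mul_iff x).mp (hx i hi), zero_add,
        show x⁻¹ * (x * cs.simple i * x⁻¹) * x⁻¹⁻¹ = cs.simple i by group,
        reflectionParity_mul, (hs.lt_length_mul_iff p).mp hlt, h1, add_zero]

end Closure

/-! ### Existence of the join. -/

section Join

variable {B W : Type*} [Group W] {M : CoxeterMatrix B} (cs : CoxeterSystem M W)

theorem exists_rightWeakLE_mul_simple_of_closed {A : Set W} {w : W} (hA : cs.bruhatPreclosure A ⊆ A)
    (hw : A ⊆ cs.inversionSet w) {x : W} (hxA : cs.inversionSet x ⊆ A) {J : Set B}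
    (hx : ∀ i ∈ J, cs.length x < cs.length (x * cs.simple i))
    (hJ : ∀ i ∈ J, cs.inversionSet (x * cs.simple i) ⊆ A) :
    ∃ z, cs.inversionSet z ⊆ A ∧ ∀ i ∈ J, cs.RightWeakLE (x * cs.simple i) z := by
  have hadd := fun {y : W} (hy : y ∈ cs.parabolic J) => cs.length_mul_of_mem_parabolic hx hy
  have hgen : ∀ i ∈ J, x * cs.simple i * x⁻¹ ∈ A := fun i hi => hJ i hi
    ⟨(cs.isReflection_simple i).conj x, by simpa [mul_assoc] using hx i hi⟩
  -- An inversion of x y is an inversion of x or has the form x d x⁻¹ with d an inversion of y,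
  -- hence d in the parabolic subgroup.
  have hmem : ∀ y ∈ cs.parabolic J, cs.inversionSet (x * y) ⊆ A := by
    intro y hy t ht
    obtain ⟨htr, ht1⟩ := cs.mem_inversionSet_iff.mp ht
    rw [mul_inv_rev, reflectionParity_mul, inv_inv] at ht1
    by_cases h : cs.reflectionParity x⁻¹ t = 1
    · exact hxA (cs.mem_inversionSet_iff.mpr ⟨htr, h⟩)
    · have hd : cs.IsReflection (x⁻¹ * t * x) := by simpa using htr.conj x⁻¹
      have h1 : cs.reflectionParity y⁻¹ (x⁻¹ * t * x) = 1 := by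
        generalize cs.reflectionParity x⁻¹ t = a at h ht1
        generalize cs.reflectionParity y⁻¹ (x⁻¹ * t * x) = b at ht1
        revert a b
        decide
      have h2 := hA (cs.conj_mem_bruhatPreclosure hx hgen hd
        (cs.mem_parabolic_of_mem_inversionSet hy (cs.mem_inversionSet_iff.mpr ⟨hd, h1⟩)))
      rwa [show x * (x⁻¹ * t * x) * x⁻¹ = t by group] at h2
  have hbound : ∀ y ∈ cs.parabolic J, cs.length y ≤ cs.length w := by
    intro y hy
    have h1 := cs.rightWeakLE_iff_inversionSet_subset.mpr ((hmem y hy).trans hw)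
    rw [rightWeakLE_iff] at h1
    have h2 := hadd hy
    omega
  obtain ⟨y, hy, hmax⟩ : ∃ y ∈ cs.parabolic J, ∀ y' ∈ cs.parabolic J,
      cs.length y' ≤ cs.length y := by
    have hfin : (cs.length '' (cs.parabolic J : Set W)).Finite :=
      (Set.finite_Iic (cs.length w)).subset (by rintro _ ⟨y, hy, rfl⟩; exact hbound y hy)
    obtain ⟨y, hy, hmax⟩ := Set.exists_max_image (cs.length '' (cs.parabolic J : Set W)) id hfin
      ⟨_, 1, one_mem _, rfl⟩
    obtain ⟨y, hy, rfl⟩ := hy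
    exact ⟨y, hy, fun y' hy' => hmax _ ⟨y', hy', rfl⟩⟩
  refine ⟨x * y, hmem y hy, fun i hi => ?_⟩
  -- Maximality of y makes each generator in J a left descent of y.
  have h1 := hmax _ (mul_mem (cs.simple_mem_parabolic hi) hy)
  have h2 := hadd hy
  have h3 := hx i hi
  rw [rightWeakLE_iff, show (x * cs.simple i)⁻¹ * (x * y) = cs.simple i * y by simp [mul_assoc]]
  rcases cs.length_simple_mul y i with h' | h' <;>
  rcases cs.length_mul_simple x i with h'' | h'' <;> omega

/-- Induction on ℓ(w) − ℓ(x): every admissible cover of x has a greatest element above it, and the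
local upper bounds force these to agree. -/
theorem exists_greatest_of_closed {A : Set W} {w : W} (hA : cs.bruhatPreclosure A ⊆ A)
    (hw : A ⊆ cs.inversionSet w) {x : W} (hxA : cs.inversionSet x ⊆ A) :
    ∃ m, cs.inversionSet m ⊆ A ∧
      ∀ y, cs.inversionSet y ⊆ A → cs.RightWeakLE x y → cs.RightWeakLE y m := by
  induction hn : cs.length w - cs.length x using Nat.strong_induction_on generalizing x with
  | _ n ih =>
    have hlen : ∀ {y}, cs.inversionSet y ⊆ A → cs.length y ≤ cs.length w := fun hy => by
      have := cs.rightWeakLE_iff_inversionSet_subset.mpr (hy.trans hw)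
      rw [rightWeakLE_iff] at this
      omega
    have step : ∀ {i}, cs.length x < cs.length (x * cs.simple i) →
        cs.inversionSet (x * cs.simple i) ⊆ A → ∃ m, cs.inversionSet m ⊆ A ∧
        ∀ y, cs.inversionSet y ⊆ A → cs.RightWeakLE (x * cs.simple i) y → cs.RightWeakLE y m :=
      fun hlt hi => ih _ (by have := hlen hi; omega) hi rfl
    by_cases hatom : ∃ i, cs.length x < cs.length (x * cs.simple i) ∧
        cs.inversionSet (x * cs.simple i) ⊆ A
    · obtain ⟨i, hlt, hi⟩ := hatom
      obtain ⟨m, hm, hmax⟩ := step hlt hi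
      refine ⟨m, hm, fun y hy hxy => ?_⟩
      by_cases hne : x = y
      · subst hne
        exact (cs.rightWeakLE_mul_simple hlt).trans (hmax _ hi (cs.rightWeakOrder.le_refl _))
      · obtain ⟨i', hlt', hle'⟩ := hxy.exists_mul_simple hne
        have hi' := hle'.inversionSet_subset.trans hy
        obtain ⟨m', hm', hmax'⟩ := step hlt' hi'
        obtain ⟨z, hz, hzle⟩ := cs.exists_rightWeakLE_mul_simple_of_closed hA hw hxA
          (J := {i, i'}) (by rintro j (rfl | rfl) <;> assumption)
          (by rintro j (rfl | rfl) <;> assumption)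
        -- As z lies above both covers, m' lies above z and so above the cover that defines m; hence
        -- y ≤ m' ≤ m.
        have h1 := hmax' z hz (hzle i' (by simp))
        exact (hmax' y hy hle').trans (hmax m' hm' ((hzle i (by simp)).trans h1))
    · refine ⟨x, hxA, fun y hy hxy => ?_⟩
      by_cases hne : x = y
      · subst hne
        exact cs.rightWeakOrder.le_refl _
      · obtain ⟨i, hlt, hle⟩ := hxy.exists_mul_simple hne
        exact absurd ⟨i, hlt, hle.inversionSet_subset.trans hy⟩ hatom

theorem isRightJoin_iff {u v j : W} :
    cs.IsRightJoin u v j ↔ cs.RightWeakLE u j ∧ cs.RightWeakLE v j ∧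
      ∀ w, cs.RightWeakLE u w → cs.RightWeakLE v w → cs.RightWeakLE j w := by
  let _ := cs.rightWeakOrder
  change IsLUB {u, v} j ↔ u ≤ j ∧ v ≤ j ∧ ∀ w, u ≤ w → v ≤ w → j ≤ w
  simp [IsLUB, IsLeast, upperBounds, lowerBounds, and_assoc]

theorem IsRightJoin.unique {cs : CoxeterSystem M W} {u v j j' : W} (h : cs.IsRightJoin u v j)
    (h' : cs.IsRightJoin u v j') : j = j' :=
  let _ := cs.rightWeakOrder
  IsLUB.unique h h'

theorem exists_isRightJoin_inversionSet_eq {u v w : W} (hu : cs.RightWeakLE u w)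
    (hv : cs.RightWeakLE v w) :
    ∃ j, cs.IsRightJoin u v j ∧
      cs.inversionSet j = cs.infiniteBruhatClosure (cs.inversionSet u ∪ cs.inversionSet v) := by
  set A := cs.infiniteBruhatClosure (cs.inversionSet u ∪ cs.inversionSet v)
  have hle : ∀ {z}, cs.RightWeakLE u z → cs.RightWeakLE v z → A ⊆ cs.inversionSet z :=
    fun h h' => cs.infiniteBruhatClosure_subset_inversionSet
      (Set.union_subset h.inversionSet_subset h'.inversionSet_subset)
  have hA : cs.bruhatPreclosure A ⊆ A := cs.bruhatPreclosure_infiniteBruhatClosure_subset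
    (by rintro t (ht | ht) <;> exact ht.1)
  have hsub : cs.inversionSet u ∪ cs.inversionSet v ⊆ A := cs.subset_infiniteBruhatClosure _
  have hone : ∀ {y}, cs.RightWeakLE 1 y := by simp [rightWeakLE_iff]
  obtain ⟨j, hj, hmax⟩ := cs.exists_greatest_of_closed hA (hle hu hv) (x := 1)
    (fun t ht => absurd ht.2 (by simp))
  have huj := hmax u (Set.subset_union_left.trans hsub) hone
  have hvj := hmax v (Set.subset_union_right.trans hsub) hone
  refine ⟨j, cs.isRightJoin_iff.mpr ⟨huj, hvj, fun z hz hz' => ?_⟩, hj.antisymm (hle huj hvj)⟩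
  exact cs.rightWeakLE_iff_inversionSet_subset.mpr (hj.trans (hle hz hz'))

end Join

end CoxeterSystem

theorem mainTheorem1 {B W : Type*} [Group W] {M : CoxeterMatrix B} (cs : CoxeterSystem M W)
    (u v : W) (hbdd : ∃ w : W, cs.RightWeakLE u w ∧ cs.RightWeakLE v w) :
    (∃ j : W, cs.IsRightJoin u v j) ∧
      ∀ j : W, cs.IsRightJoin u v j →
        cs.inversionSet j =
          cs.infiniteBruhatClosure (cs.inversionSet u ∪ cs.inversionSet v) := by
  obtain ⟨w, hu, hv⟩ := hbdd
  obtain ⟨j, hj, hN⟩ := cs.exists_isRightJoin_inversionSet_eq hu hv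
  exact ⟨⟨j, hj⟩, fun j' hj' => hj'.unique hj ▸ hN⟩
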